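/- **Setting.** Let $H$ be a complex Hilbert space, $\mathbb D=\{|z|<1\}$, $\mathbb T=\{|z|=1\}$, and let $V$ be a closed isometric operator in $H$, with domain $D(V)\subseteq H$ (a linear subspace, not necessarily dense). For $\zeta\in\mathbb C$ put $M_\zeta=(E_H-\zeta V)D(V)$ and $N_\zeta=H\ominus M_\zeta$. For $z\in\mathbb D$ put $V_z=(V-\bar z E_H)(E_H-zV)^{-1}$, an isometric operator with domain $M_z$. For $z_0\in\mathbb D\setminus\{0\}$ and a bounded linear operator $C:N_{z_0}\to N_{1/\bar z_0}$ put $V^+_{z_0;C}=V_{z_0}\oplus C$, and define the orthogonal extension of $V$ determined by $C$ as $$V_{C;z_0}=(V^+_{z_0;C}+\bar z_0E_H)(E_H+z_0V^+_{z_0;C})^{-1}.$$ Let $U$ be a unitary operator in a Hilbert space $\widetilde H\supseteq H$ that extends $V$, and let $\mathbf R_\zeta=P_H(E_{\widetilde H}-\zeta U)^{-1}|_H$ $(|\zeta|\ne1)$ be the corresponding generalized resolvent of $V$. For $z_0\in\mathbb D\setminus\{0\}$, a function $C(\cdot\,;z_0)$ on $\mathbb D$, analytic in the operator norm, whose values are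 linear contractions $N_{z_0}\to N_{1/\bar z_0}$, is said to correspond to $\mathbf R$ by Inin's formula if $$\mathbf R_\zeta=\left[E_H-\zeta V_{C(\zeta;z_0);z_0}\right]^{-1}\qquad\text{for all }\zeta\in\mathbb D .$$ **Theorem.** Let $\lambda_k\in\mathbb D$ $(k\ge 1)$ with $\lambda_k\to\widehat\lambda\in\mathbb T$. Suppose that for some $z_0\in\mathbb D\setminus\{0\}$ the function $C(\cdot\,;z_0)$ corresponding to $\mathbf R$ by Inin's formula is such that $C(\lambda_k;z_0)$ converges in the operator norm, with limit $C(\widehat\lambda;z_0)$. Then for every $z_0'\in\mathbb D\setminus\{0\}$ there is a function $C(\cdot\,;z_0')$ corresponding to $\mathbf R$ by Inin's formula, and for any such function $C(\lambda_k;z_0')$ converges in the operator norm; its limit $C(\widehat\lambda;z_0')$ is a linear contraction from $N_{z_0'}$ into $N_{1/\bar z_0'}$, and $$V_{C(\widehat\lambda;z_0');z_0'}=V_{C(\widehat\lambda;z_0);z_0},$$ so that the limiting orthogonal extension does not depend on $z_0'$. -/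

import Mathlib

open Filter Topology

open scoped ComplexConjugate

noncomputable section

namespace IsometricOp

variable {H : Type*} [NormedAddCommGroup H] [InnerProductSpace ℂ H]

/-- The identity operator `E` of `H`, as an operator with domain `H`. -/
def idOp : H →ₗ.[ℂ] H := (LinearMap.id : H →ₗ[ℂ] H).toPMap ⊤

/-- The product `B A` of two operators with domains in `H`:
its domain is `{x ∈ D(A) : A x ∈ D(B)}`, and `(B A) x = B (A x)`. -/
def mulOp (B A : H →ₗ.[ℂ] H) : H →ₗ.[ℂ] H :=
  B.comp (A.domRestrict ((B.domain.comap A.toFun).map A.domain.subtype)) (by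
    rintro ⟨x, ⟨y, hy, rfl⟩, hx⟩
    exact hy)

/-- `V` is isometric: `‖V x‖ = ‖x‖` on the domain of `V` (any subspace, not necessarily dense). -/
def IsIsometric (V : H →ₗ.[ℂ] H) : Prop := ∀ x : V.domain, ‖V x‖ = ‖(x : H)‖

/-- `M_ζ(V) = (E - ζ V) D(V)`. -/
def rangeSpace (V : H →ₗ.[ℂ] H) (ζ : ℂ) : Submodule ℂ H :=
  LinearMap.range (idOp - ζ • V).toFun

/-- `N_ζ(V) = H ⊖ M_ζ(V)`. -/
def defectSpace (V : H →ₗ.[ℂ] H) (ζ : ℂ) : Submodule ℂ H := (rangeSpace V ζ)ᗮ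

/-- The type of bounded linear operators defined on `N_{z₀}` with values in `N_{1 / z̄₀}`
(used only for `z₀ ≠ 0`), with the operator norm. -/
abbrev Param (V : H →ₗ.[ℂ] H) (z₀ : ℂ) : Type _ :=
  defectSpace V z₀ →L[ℂ] defectSpace V (1 / conj z₀)

/-- `V_z = (V - z̄ E) (E - z V)⁻¹`. -/
def mobius (V : H →ₗ.[ℂ] H) (z : ℂ) : H →ₗ.[ℂ] H :=
  mulOp (V - conj z • idOp) (idOp - z • V).inverse

/-- A bounded operator `C : N_{z₀} → N_{1 / z̄₀}` regarded as an operator in `H` with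
domain `N_{z₀}`. -/
def paramOp {V : H →ₗ.[ℂ] H} {z₀ : ℂ} (C : Param V z₀) : H →ₗ.[ℂ] H where
  domain := defectSpace V z₀
  toFun := (defectSpace V (1 / conj z₀)).subtype ∘ₗ (C : defectSpace V z₀ →ₗ[ℂ] _)

/-- `V⁺_{z₀;C} = V_{z₀} ⊕ C`, the operator `x + y ↦ V_{z₀} x + C y` for
`x ∈ D(V_{z₀}) = M_{z₀}` and `y ∈ N_{z₀}`; its graph is the sum of the two graphs. -/
def plusOp {V : H →ₗ.[ℂ] H} {z₀ : ℂ} (C : Param V z₀) : H →ₗ.[ℂ] H :=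
  ((mobius V z₀).graph ⊔ (paramOp C).graph).toLinearPMap

/-- The orthogonal extension of `V` defined by `C`:
`V_{C;z₀} = (V⁺_{z₀;C} + z̄₀ E) (E + z₀ V⁺_{z₀;C})⁻¹`. -/
def orthogonalExtension {V : H →ₗ.[ℂ] H} {z₀ : ℂ} (C : Param V z₀) : H →ₗ.[ℂ] H :=
  mulOp (plusOp C + conj z₀ • idOp) (idOp + z₀ • plusOp C).inverse

/-- The class `𝒮(N_{z₀}; N_{1 / z̄₀})`: functions analytic in the open unit disc (for the operator
norm) whose values there are contractions from `N_{z₀}` into `N_{1 / z̄₀}`. Values outside the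
disc are irrelevant. -/
def IsSchur {V : H →ₗ.[ℂ] H} {z₀ : ℂ} (C : ℂ → Param V z₀) : Prop :=
  AnalyticOnNhd ℂ C (Metric.ball 0 1) ∧ ∀ ζ ∈ Metric.ball (0 : ℂ) 1, ‖C ζ‖ ≤ 1

/-- For a unitary operator `U` in a Hilbert space `K` and an isometric embedding `J : H → K`
(so that `J†` is the orthogonal projection of `K` onto `H`), the function
`ζ ↦ P_H (E_K - ζ U)⁻¹ |_H`, `|ζ| ≠ 1`. -/
def generalizedResolvent {K : Type*} [NormedAddCommGroup K] [InnerProductSpace ℂ K]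
    [CompleteSpace H] [CompleteSpace K] (J : H →ₗᵢ[ℂ] K) (U : K ≃ₗᵢ[ℂ] K) (ζ : ℂ) : H →L[ℂ] H :=
  (ContinuousLinearMap.adjoint J.toContinuousLinearMap) ∘L
    (Ring.inverse (1 - ζ • (U.toContinuousLinearEquiv : K →L[ℂ] K))) ∘L
    J.toContinuousLinearMap

/-- `C = C(·; z₀)` is the function of class `𝒮(N_{z₀}; N_{1 / z̄₀})` that corresponds to `R` by
Inin's formula: `R_ζ = [E - ζ V_{C(ζ);z₀}]⁻¹` for all `ζ` in the open unit disc. -/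
def IsIninParameter (V : H →ₗ.[ℂ] H) (R : ℂ → H →L[ℂ] H) (z₀ : ℂ) (C : ℂ → Param V z₀) : Prop :=
  IsSchur C ∧ ∀ ζ ∈ Metric.ball (0 : ℂ) 1,
    (R ζ : H →ₗ[ℂ] H).toPMap ⊤ = (idOp - ζ • orthogonalExtension (C ζ)).inverse

end IsometricOp

end

/-!
Fix one everywhere defined contraction `T₀` extending `V`. For `z` in the disc, `T ↦ T_z` maps the
contractive extensions of `V` onto those of the isometric operator `V_z`. A contractive extension
of `V_z` sends `N_z`, the complement of its domain, into `N_{1 / z̄}`, the complement of its range,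
so it is `V_z ⊕ C` for a unique contraction `C`. Hence `C ↦ V_{C;z}` is a bijection from
contractions to contractive extensions of `V`, and it is analytic in both directions.
Composing the bijection at `z₀` with the inverse of the one at `z₁` carries the parameter of `R` at
`z₀` to its parameter at `z₁` without changing the orthogonal extension, and preserves limits.
-/

namespace IsometricOp

section DiskMobius

variable {A : Type*}

/-- The Möbius transformation `a ↦ (a - z̄) (1 - z a)⁻¹` of a complex algebra, the everywhere
defined counterpart of `mobius`. It is `0` when `1 - z a` is not invertible. -/
noncomputable def diskMobius [Ring A] [Algebra ℂ A] (z : ℂ) (a : A) : A :=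
  (a - conj z • 1) * Ring.inverse (1 - z • a)

theorem one_sub_mul_conj_ne_zero {z : ℂ} (hz : ‖z‖ < 1) : 1 - z * conj z ≠ 0 := by
  rw [Complex.mul_conj, Complex.normSq_eq_norm_sq]
  norm_cast
  nlinarith [norm_nonneg z]

theorem diskMobius_mul_one_sub [Ring A] [Algebra ℂ A] {z : ℂ} {a : A} (ha : IsUnit (1 - z • a)) :
    diskMobius z a * (1 - z • a) = a - conj z • 1 :=
  Ring.inverse_mul_cancel_right _ _ ha

theorem diskMobius_neg_diskMobius [Ring A] [Algebra ℂ A] {z : ℂ} (hz : ‖z‖ < 1) {a : A}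
    (ha : IsUnit (1 - z • a)) : diskMobius (-z) (diskMobius z a) = a := by
  set r := Ring.inverse (1 - z • a)
  set k := 1 - z * conj z
  have hr_unit : IsUnit r := ha.ringInverse
  have h_one : (1 - z • a) * r = 1 := Ring.mul_inverse_cancel _ ha
  have h_den : 1 - -z • diskMobius z a = k • r := calc
    1 - -z • diskMobius z a = (1 - z • a) * r + z • ((a - conj z • 1) * r) := by
      rw [h_one, neg_smul, sub_neg_eq_add, diskMobius]
    _ = k • r := by
      simp only [sub_mul, smul_mul_assoc, one_mul]
      module
  have h_num : diskMobius z a - conj (-z) • 1 = a * (k • r) := calc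
    diskMobius z a - conj (-z) • 1 = (a - conj z • 1) * r + conj z • ((1 - z • a) * r) := by
      rw [h_one, map_neg, neg_smul, sub_neg_eq_add, diskMobius]
    _ = a * (k • r) := by
      simp only [sub_mul, smul_mul_assoc, one_mul, mul_smul_comm]
      module
  have h_unit : IsUnit (k • r) :=
    (hr_unit.smul (Units.mk0 k (one_sub_mul_conj_ne_zero hz)) :)
  rw [diskMobius, h_num, h_den, Ring.mul_inverse_cancel_right _ _ h_unit]

variable [NormedRing A] [NormedAlgebra ℂ A] [CompleteSpace A] {z : ℂ} {a : A}

theorem isUnit_one_sub_smul (hz : ‖z‖ < 1) (ha : ‖a‖ ≤ 1) : IsUnit (1 - z • a) := by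
  refine isUnit_one_sub_of_norm_lt_one ?_
  rw [norm_smul]
  exact (mul_le_of_le_one_right (norm_nonneg z) ha).trans_lt hz

theorem diskMobius_diskMobius_neg (hz : ‖z‖ < 1) (ha : ‖a‖ ≤ 1) :
    diskMobius z (diskMobius (-z) a) = a := by
  rw [← norm_neg] at hz
  simpa only [neg_neg] using diskMobius_neg_diskMobius hz (isUnit_one_sub_smul hz ha)

theorem analyticAt_diskMobius (ha : IsUnit (1 - z • a)) : AnalyticAt ℂ (diskMobius z) a := by
  have h_num : AnalyticAt ℂ (fun b : A => b - conj z • 1) a := by fun_prop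
  have h_den : AnalyticAt ℂ (fun b : A => 1 - z • b) a := by fun_prop
  have h_inv : AnalyticAt ℂ Ring.inverse (1 - z • a) := ha.unit_spec ▸ analyticAt_inverse ha.unit
  exact h_num.mul (AnalyticAt.fun_comp (f := fun b : A => 1 - z • b) h_inv h_den)

end DiskMobius

section Contraction

variable {H : Type*} [NormedAddCommGroup H] [InnerProductSpace ℂ H]

theorem norm_sub_conj_smul_sq (z : ℂ) (x y : H) :
    ‖y - conj z • x‖ ^ 2 = ‖x - z • y‖ ^ 2 - (1 - ‖z‖ ^ 2) * (‖x‖ ^ 2 - ‖y‖ ^ 2) := by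
  have h : RCLike.re (inner ℂ y (conj z • x)) = RCLike.re (inner ℂ x (z • y)) := by
    rw [inner_smul_right, inner_smul_right, ← inner_conj_symm y x, ← map_mul, RCLike.conj_re]
  rw [norm_sub_sq (𝕜 := ℂ), norm_sub_sq (𝕜 := ℂ), h, norm_smul, norm_smul, RCLike.norm_conj]
  ring

variable [CompleteSpace H] {z : ℂ} {T : H →L[ℂ] H}

theorem diskMobius_apply_sub (hz : ‖z‖ < 1) (hT : ‖T‖ ≤ 1) (x : H) :
    diskMobius z T (x - z • T x) = T x - conj z • x :=
  DFunLike.congr_fun (diskMobius_mul_one_sub (isUnit_one_sub_smul hz hT)) x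

theorem norm_diskMobius_le (hz : ‖z‖ < 1) (hT : ‖T‖ ≤ 1) : ‖diskMobius z T‖ ≤ 1 := by
  refine ContinuousLinearMap.opNorm_le_bound _ zero_le_one fun y => ?_
  obtain ⟨x, rfl⟩ : ∃ x, x - z • T x = y := ⟨Ring.inverse (1 - z • T) y,
    DFunLike.congr_fun (Ring.mul_inverse_cancel _ (isUnit_one_sub_smul hz hT)) y⟩
  have hTx : ‖T x‖ ≤ ‖x‖ := by simpa only [one_mul] using T.le_of_opNorm_le hT x
  have h_nonneg : 0 ≤ (1 - ‖z‖ ^ 2) * (‖x‖ ^ 2 - ‖T x‖ ^ 2) :=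
    mul_nonneg (sub_nonneg.2 (pow_le_one₀ (norm_nonneg z) hz.le)) (sub_nonneg.2 (by gcongr))
  rw [diskMobius_apply_sub hz hT, one_mul, ← sq_le_sq₀ (norm_nonneg _) (norm_nonneg _),
    norm_sub_conj_smul_sq]
  linarith

end Contraction

section Gluing

variable {𝕜 E F : Type*} [RCLike 𝕜] [NormedAddCommGroup E] [InnerProductSpace 𝕜 E]
  [NormedAddCommGroup F] [InnerProductSpace 𝕜 F]
  {N : Submodule 𝕜 E} [N.HasOrthogonalProjection] {M : Submodule 𝕜 F}

/-- The operator that agrees with `C` on `N` and with `W` on `Nᗮ`. -/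
noncomputable def glue (W : E →L[𝕜] F) (C : N →L[𝕜] M) : E →L[𝕜] F :=
  W ∘L Nᗮ.starProjection + M.subtypeL ∘L C ∘L N.orthogonalProjectionOnto

theorem glue_apply_coe (W : E →L[𝕜] F) (C : N →L[𝕜] M) (y : N) : glue W C y = C y := by
  simp [glue]

theorem glue_apply_of_mem_orthogonal (W : E →L[𝕜] F) (C : N →L[𝕜] M) {x : E} (hx : x ∈ Nᗮ) :
    glue W C x = W x := by
  simp [glue, Submodule.starProjection_eq_self_iff.2 hx,
    Submodule.orthogonalProjectionOnto_apply_of_mem_orthogonal hx]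

theorem norm_glue_le {W : E →L[𝕜] F} {C : N →L[𝕜] M} (hW : ∀ x ∈ Nᗮ, ‖W x‖ ≤ ‖x‖)
    (hWM : ∀ x ∈ Nᗮ, W x ∈ Mᗮ) (hC : ‖C‖ ≤ 1) : ‖glue W C‖ ≤ 1 := by
  refine ContinuousLinearMap.opNorm_le_bound _ zero_le_one fun h => ?_
  obtain ⟨y, hy, x, hx, rfl⟩ := N.exists_add_mem_mem_orthogonal h
  lift y to N using hy
  have hCy : ‖(C y : F)‖ ≤ ‖(y : E)‖ := by
    rw [← one_mul ‖(y : E)‖]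
    exact C.le_of_opNorm_le hC y
  rw [one_mul, map_add, glue_apply_coe, glue_apply_of_mem_orthogonal W C hx,
    ← sq_le_sq₀ (norm_nonneg _) (norm_nonneg _), sq, sq,
    norm_add_sq_eq_norm_sq_add_norm_sq_of_inner_eq_zero _ _
      (Submodule.inner_right_of_mem_orthogonal (C y).2 (hWM x hx)),
    norm_add_sq_eq_norm_sq_add_norm_sq_of_inner_eq_zero _ _
      (Submodule.inner_right_of_mem_orthogonal y.2 hx)]
  have := hW x hx
  gcongr

theorem analyticAt_glue (W : E →L[𝕜] F) (C : N →L[𝕜] M) :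
    AnalyticAt 𝕜 (glue W : (N →L[𝕜] M) → E →L[𝕜] F) C :=
  analyticAt_const.add
    (((ContinuousLinearMap.compL 𝕜 E M F M.subtypeL) ∘L
      (ContinuousLinearMap.compL 𝕜 E N M).flip N.orthogonalProjectionOnto).analyticAt C)

variable [M.HasOrthogonalProjection]

variable (N M) in
/-- The compression `P_M W|_N` of `W` to an operator from `N` to `M`. -/
noncomputable def compression (W : E →L[𝕜] F) : N →L[𝕜] M :=
  M.orthogonalProjectionOnto ∘L W ∘L N.subtypeL

omit [N.HasOrthogonalProjection] in
theorem norm_compression_le (W : E →L[𝕜] F) : ‖compression N M W‖ ≤ ‖W‖ :=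
  ContinuousLinearMap.opNorm_le_bound _ (norm_nonneg W) fun y =>
    (M.norm_orthogonalProjectionOnto_apply_le (W y)).trans (W.le_opNorm y)

omit [N.HasOrthogonalProjection] in
theorem analyticAt_compression (W : E →L[𝕜] F) : AnalyticAt 𝕜 (compression N M) W :=
  ((ContinuousLinearMap.compL 𝕜 N F M M.orthogonalProjectionOnto) ∘L
    (ContinuousLinearMap.compL 𝕜 N E F).flip N.subtypeL).analyticAt W

theorem compression_glue (W : E →L[𝕜] F) (C : N →L[𝕜] M) : compression N M (glue W C) = C := by
  ext1 y
  simp only [compression, ContinuousLinearMap.comp_apply, Submodule.subtypeL_apply, glue_apply_coe,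
    Submodule.orthogonalProjectionOnto_mem_subspace_eq_self]

theorem glue_compression {W₀ W : E →L[𝕜] F} (hN : ∀ y ∈ N, W y ∈ M) (hW₀ : ∀ x ∈ Nᗮ, W₀ x = W x) :
    glue W₀ (compression N M W) = W := by
  ext h
  obtain ⟨y, hy, x, hx, rfl⟩ := N.exists_add_mem_mem_orthogonal h
  rw [map_add, map_add, glue_apply_of_mem_orthogonal _ _ hx, hW₀ x hx]
  congr 1
  exact (glue_apply_coe _ _ ⟨y, hy⟩).trans (Submodule.starProjection_eq_self_iff.2 (hN y hy))

omit [N.HasOrthogonalProjection] [M.HasOrthogonalProjection] in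
theorem inner_map_map_eq_zero_of_norm_map_eq [CompleteSpace E] [CompleteSpace F] {W : E →L[𝕜] F}
    (hW : ‖W‖ ≤ 1) {x y : E} (hx : ‖W x‖ = ‖x‖) (hxy : inner 𝕜 x y = 0) :
    inner 𝕜 (W x) (W y) = 0 := by
  have h_adjoint : W.adjoint (W x) = x := by
    refine eq_of_norm_le_re_inner_eq_norm_sq (𝕜 := 𝕜) ?_ ?_
    · rw [← hx, ← one_mul ‖W x‖]
      exact W.adjoint.le_of_opNorm_le ((LinearIsometryEquiv.norm_map _ W).le.trans hW) (W x)
    · rw [ContinuousLinearMap.adjoint_inner_left, inner_self_eq_norm_sq, hx]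
  rw [← ContinuousLinearMap.adjoint_inner_left, h_adjoint, hxy]

end Gluing

section LinearPMap

variable {H : Type*} [NormedAddCommGroup H] [InnerProductSpace ℂ H]

theorem mem_graph_mulOp {B A : H →ₗ.[ℂ] H} {a c : H} :
    (a, c) ∈ (mulOp B A).graph ↔ ∃ b, (a, b) ∈ A.graph ∧ (b, c) ∈ B.graph := by
  constructor
  · rintro h
    obtain ⟨⟨_, ⟨x, hx, rfl⟩, _⟩, rfl, rfl⟩ := (LinearPMap.mem_graph_iff _).1 h
    exact ⟨A x, A.mem_graph x, B.mem_graph ⟨A x, hx⟩⟩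
  · rintro ⟨b, hab, hbc⟩
    obtain ⟨x, rfl, rfl⟩ := (LinearPMap.mem_graph_iff _).1 hab
    obtain ⟨⟨_, hx⟩, hAx, hc⟩ := (LinearPMap.mem_graph_iff _).1 hbc
    subst hAx
    exact (LinearPMap.mem_graph_iff _).2 ⟨⟨x, ⟨x, hx, rfl⟩, x.2⟩, rfl, hc⟩

theorem mem_graph_inverse {A : H →ₗ.[ℂ] H} (hA : LinearMap.ker A.toFun = ⊥) {a b : H} :
    (a, b) ∈ A.inverse.graph ↔ (b, a) ∈ A.graph := by
  rw [LinearPMap.inverse_graph hA]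
  simp

theorem mem_graph_idOp_sub_smul {V : H →ₗ.[ℂ] H} {z : ℂ} {a b : H} :
    (a, b) ∈ (idOp - z • V).graph ↔ ∃ x : V.domain, (x : H) = a ∧ (x : H) - z • V x = b := by
  rw [LinearPMap.mem_graph_iff]
  exact ⟨fun ⟨x, hx⟩ => ⟨⟨x, x.2.2⟩, hx⟩, fun ⟨x, hx⟩ => ⟨⟨x, trivial, x.2⟩, hx⟩⟩

theorem mem_graph_sub_smul_idOp {V : H →ₗ.[ℂ] H} {z : ℂ} {a b : H} :
    (a, b) ∈ (V - z • idOp).graph ↔ ∃ x : V.domain, (x : H) = a ∧ V x - z • (x : H) = b := by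
  rw [LinearPMap.mem_graph_iff]
  exact ⟨fun ⟨x, hx⟩ => ⟨⟨x, x.2.1⟩, hx⟩, fun ⟨x, hx⟩ => ⟨⟨x, x.2, trivial⟩, hx⟩⟩

theorem mem_rangeSpace {V : H →ₗ.[ℂ] H} {z : ℂ} {h : H} :
    h ∈ rangeSpace V z ↔ ∃ x : V.domain, (x : H) - z • V x = h :=
  ⟨fun ⟨x, hx⟩ => ⟨⟨x, x.2.2⟩, hx⟩, fun ⟨x, hx⟩ => ⟨⟨x, trivial, x.2⟩, hx⟩⟩

theorem mem_graph_toPMap_top {T : H →L[ℂ] H} {a b : H} :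
    (a, b) ∈ ((T : H →ₗ[ℂ] H).toPMap ⊤).graph ↔ T a = b := by
  simp [LinearPMap.mem_graph_iff]

theorem toPMap_top_injective :
    Function.Injective fun T : H →L[ℂ] H => (T : H →ₗ[ℂ] H).toPMap ⊤ := fun S T h => by
  have h' : (S : H →ₗ[ℂ] H).toPMap ⊤ = (T : H →ₗ[ℂ] H).toPMap ⊤ := h
  ext x
  have hx : (x, S x) ∈ ((T : H →ₗ[ℂ] H).toPMap ⊤).graph := h' ▸ mem_graph_toPMap_top.2 rfl
  exact (mem_graph_toPMap_top.1 hx).symm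

theorem toPMap_top_add_smul_idOp (T : H →L[ℂ] H) (c : ℂ) :
    (T : H →ₗ[ℂ] H).toPMap ⊤ + c • idOp = ((T + c • 1 : H →L[ℂ] H) : H →ₗ[ℂ] H).toPMap ⊤ :=
  LinearPMap.ext (top_inf_eq ⊤) fun _ _ _ => rfl

theorem idOp_add_smul_toPMap_top (T : H →L[ℂ] H) (c : ℂ) :
    idOp + c • (T : H →ₗ[ℂ] H).toPMap ⊤ = ((1 + c • T : H →L[ℂ] H) : H →ₗ[ℂ] H).toPMap ⊤ :=
  LinearPMap.ext (top_inf_eq ⊤) fun _ _ _ => rfl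

theorem idOp_sub_smul_toPMap_top (T : H →L[ℂ] H) (c : ℂ) :
    idOp - c • (T : H →ₗ[ℂ] H).toPMap ⊤ = ((1 - c • T : H →L[ℂ] H) : H →ₗ[ℂ] H).toPMap ⊤ :=
  LinearPMap.ext (top_inf_eq ⊤) fun _ _ _ => rfl

theorem mulOp_toPMap_top (S T : H →L[ℂ] H) :
    mulOp ((S : H →ₗ[ℂ] H).toPMap ⊤) ((T : H →ₗ[ℂ] H).toPMap ⊤) =
      ((S * T : H →L[ℂ] H) : H →ₗ[ℂ] H).toPMap ⊤ := by
  apply LinearPMap.eq_of_eq_graph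
  ext ⟨a, b⟩
  simp only [mem_graph_mulOp, mem_graph_toPMap_top, exists_eq_left', mul_apply_eq_comp]

theorem inverse_toPMap_top {T : H →L[ℂ] H} (hT : IsUnit T) :
    ((T : H →ₗ[ℂ] H).toPMap ⊤).inverse = ((Ring.inverse T : H →L[ℂ] H) : H →ₗ[ℂ] H).toPMap ⊤ := by
  have h_left (x : H) : Ring.inverse T (T x) = x :=
    DFunLike.congr_fun (Ring.inverse_mul_cancel T hT) x
  have h_right (x : H) : T (Ring.inverse T x) = x :=
    DFunLike.congr_fun (Ring.mul_inverse_cancel T hT) x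
  have h_ker : LinearMap.ker ((T : H →ₗ[ℂ] H).toPMap ⊤).toFun = ⊥ :=
    LinearMap.ker_eq_bot.2 fun x y hxy =>
      Subtype.ext (Function.LeftInverse.injective h_left hxy)
  apply LinearPMap.eq_of_eq_graph
  ext ⟨a, b⟩
  rw [mem_graph_inverse h_ker, mem_graph_toPMap_top, mem_graph_toPMap_top]
  exact ⟨fun h => h ▸ h_left b, fun h => h ▸ h_right a⟩

end LinearPMap

section ContractiveExtension

variable {H : Type*} [NormedAddCommGroup H] [InnerProductSpace ℂ H] {V : H →ₗ.[ℂ] H} {z : ℂ}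

theorem mem_graph_mobius (hV : IsIsometric V) (hz : ‖z‖ < 1) {a b : H} :
    (a, b) ∈ (mobius V z).graph ↔
      ∃ x : V.domain, (x : H) - z • V x = a ∧ V x - conj z • (x : H) = b := by
  have h_ker : LinearMap.ker (idOp - z • V).toFun = ⊥ := by
    refine LinearMap.ker_eq_bot'.2 fun x hx => Subtype.ext ?_
    have hxV : (x : H) = z • V ⟨x, x.2.2⟩ := sub_eq_zero.1 hx
    have h_norm : ‖(x : H)‖ = ‖z‖ * ‖(x : H)‖ := by
      conv_lhs => rw [hxV, norm_smul, hV]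
    exact norm_eq_zero.1 (by nlinarith [norm_nonneg (x : H)])
  simp only [mobius, mem_graph_mulOp, mem_graph_inverse h_ker, mem_graph_idOp_sub_smul,
    mem_graph_sub_smul_idOp]
  constructor
  · rintro ⟨_, ⟨x, rfl, hx⟩, y, hy, rfl⟩
    obtain rfl := Subtype.ext hy
    exact ⟨y, hx, rfl⟩
  · rintro ⟨x, ha, hb⟩
    exact ⟨x, ⟨x, rfl, ha⟩, x, rfl, hb⟩

/-- An everywhere defined contraction that extends `V`. -/
structure IsContractiveExtension (V : H →ₗ.[ℂ] H) (T : H →L[ℂ] H) : Prop where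
  norm_le : ‖T‖ ≤ 1
  apply_coe (x : V.domain) : T x = V x

theorem IsContractiveExtension.rangeSpace_eq_map {T : H →L[ℂ] H} (hT : IsContractiveExtension V T)
    (z : ℂ) : rangeSpace V z = V.domain.map ((1 - z • T : H →L[ℂ] H) : H →ₗ[ℂ] H) := by
  ext h
  rw [mem_rangeSpace, Submodule.mem_map]
  constructor
  · rintro ⟨x, rfl⟩
    exact ⟨x, x.2, congrArg (fun y => (x : H) - z • y) (hT.apply_coe x)⟩
  · rintro ⟨x, hx, rfl⟩
    exact ⟨⟨x, hx⟩, congrArg (fun y => x - z • y) (hT.apply_coe ⟨x, hx⟩).symm⟩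

variable [CompleteSpace H]

theorem isClosed_domain (hV : IsIsometric V) (hVc : V.IsClosed) :
    IsClosed (V.domain : Set H) := by
  have h_graph : IsClosed (V.graph : Set (H × H)) := hVc
  have : CompleteSpace V.graph := h_graph.completeSpace_coe
  let π : V.graph →ₗᵢ[ℂ] H :=
    { toLinearMap := LinearMap.fst ℂ H H ∘ₗ V.graph.subtype
      norm_map' := by
        rintro ⟨⟨a, b⟩, hab⟩
        obtain ⟨x, rfl, rfl⟩ := (LinearPMap.mem_graph_iff _).1 hab
        exact (max_eq_left (hV x).le).symm }
  have h_range : Set.range π = V.domain := by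
    rw [← V.graph_map_fst_eq_domain]
    ext a
    simp [π]
  exact h_range ▸ π.isometry.isClosedEmbedding.isClosed_range

theorem exists_isContractiveExtension (hV : IsIsometric V) (hVc : V.IsClosed) :
    ∃ T, IsContractiveExtension V T := by
  have : CompleteSpace V.domain := (isClosed_domain hV hVc).completeSpace_coe
  let L : V.domain →ₗᵢ[ℂ] H := ⟨V.toFun, hV⟩
  refine ⟨L.toContinuousLinearMap ∘L V.domain.orthogonalProjectionOnto, ?_, fun x => ?_⟩
  · refine ContinuousLinearMap.opNorm_le_bound _ zero_le_one fun x => ?_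
    rw [one_mul]
    exact (L.norm_map _).trans_le (V.domain.norm_orthogonalProjectionOnto_apply_le x)
  · exact congrArg L (V.domain.orthogonalProjectionOnto_mem_subspace_eq_self x)

instance (V : H →ₗ.[ℂ] H) (z : ℂ) : (defectSpace V z).HasOrthogonalProjection :=
  have : CompleteSpace (defectSpace V z) := (Submodule.isClosed_orthogonal _).completeSpace_coe
  inferInstance

namespace IsContractiveExtension

variable {T : H →L[ℂ] H}

theorem isClosed_rangeSpace (hT : IsContractiveExtension V T)
    (hVd : IsClosed (V.domain : Set H)) (hz : ‖z‖ < 1) : IsClosed (rangeSpace V z : Set H) := by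
  obtain ⟨u, hu⟩ := isUnit_one_sub_smul hz hT.norm_le
  rw [hT.rangeSpace_eq_map, ← hu]
  exact (ContinuousLinearEquiv.unitsEquiv ℂ H u).toHomeomorph.isClosedMap _ hVd

theorem orthogonal_defectSpace (hT : IsContractiveExtension V T)
    (hVd : IsClosed (V.domain : Set H)) (hz : ‖z‖ < 1) :
    (defectSpace V z)ᗮ = rangeSpace V z := by
  have : CompleteSpace (rangeSpace V z) := (hT.isClosed_rangeSpace hVd hz).completeSpace_coe
  exact Submodule.orthogonal_orthogonal _

protected theorem diskMobius_apply_sub (hT : IsContractiveExtension V T) (hz : ‖z‖ < 1)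
    (x : V.domain) :
    diskMobius z T (x - z • V x) = V x - conj z • (x : H) := by
  simpa only [hT.apply_coe] using diskMobius_apply_sub hz hT.norm_le (x : H)

theorem norm_diskMobius_apply (hT : IsContractiveExtension V T) (hV : IsIsometric V) (hz : ‖z‖ < 1)
    {m : H} (hm : m ∈ rangeSpace V z) : ‖diskMobius z T m‖ = ‖m‖ := by
  obtain ⟨x, rfl⟩ := mem_rangeSpace.1 hm
  rw [hT.diskMobius_apply_sub hz, ← sq_eq_sq₀ (norm_nonneg _) (norm_nonneg _),
    norm_sub_conj_smul_sq, hV x, sub_self, mul_zero, sub_zero]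

theorem map_diskMobius_rangeSpace (hT : IsContractiveExtension V T) (hz : ‖z‖ < 1) (hz₀ : z ≠ 0) :
    (rangeSpace V z).map ((diskMobius z T : H →L[ℂ] H) : H →ₗ[ℂ] H) =
      rangeSpace V (1 / conj z) := by
  have hz' : -conj z ≠ 0 := by simpa using hz₀
  have h_smul : (diskMobius z T * (1 - z • T) : H →L[ℂ] H) =
      -conj z • (1 - (1 / conj z) • T) := by
    rw [diskMobius_mul_one_sub (isUnit_one_sub_smul hz hT.norm_le), smul_sub, smul_smul, neg_mul,
      mul_one_div_cancel (neg_ne_zero.1 hz')]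
    module
  rw [hT.rangeSpace_eq_map, hT.rangeSpace_eq_map, ← Submodule.map_comp,
    ← Submodule.map_smul (1 - (1 / conj z) • T : H →L[ℂ] H).toLinearMap _ _ hz']
  exact congrArg (fun S : H →L[ℂ] H => V.domain.map (S : H →ₗ[ℂ] H)) h_smul

theorem diskMobius_mem_orthogonal_defectSpace (hT : IsContractiveExtension V T) (hz : ‖z‖ < 1)
    (hz₀ : z ≠ 0) {m : H} (hm : m ∈ rangeSpace V z) :
    diskMobius z T m ∈ (defectSpace V (1 / conj z))ᗮ :=
  Submodule.le_orthogonal_orthogonal _ <|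
    hT.map_diskMobius_rangeSpace hz hz₀ ▸ Submodule.mem_map_of_mem hm

theorem diskMobius_mem_defectSpace (hT : IsContractiveExtension V T) (hV : IsIsometric V)
    (hz : ‖z‖ < 1) (hz₀ : z ≠ 0) {y : H} (hy : y ∈ defectSpace V z) :
    diskMobius z T y ∈ defectSpace V (1 / conj z) := by
  rw [defectSpace, ← hT.map_diskMobius_rangeSpace hz hz₀, Submodule.mem_orthogonal]
  rintro _ ⟨m, hm, rfl⟩
  exact inner_map_map_eq_zero_of_norm_map_eq (norm_diskMobius_le hz hT.norm_le)
    (hT.norm_diskMobius_apply hV hz hm) (Submodule.inner_right_of_mem_orthogonal hm hy)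

end IsContractiveExtension

end ContractiveExtension

section Parameter

variable {H : Type*} [NormedAddCommGroup H] [InnerProductSpace ℂ H] [CompleteSpace H]
  {V : H →ₗ.[ℂ] H} {z : ℂ} {T₀ T : H →L[ℂ] H} {C : Param V z}

/-- The operator `V⁺_{z;C} = V_z ⊕ C` as a bounded operator. The contractive extension `T₀` of `V`
is auxiliary: it provides an everywhere defined extension of `V_z`. -/
noncomputable def plusCLM (T₀ : H →L[ℂ] H) (C : Param V z) : H →L[ℂ] H :=
  glue (diskMobius z T₀) C

/-- The orthogonal extension `V_{C;z}` as a bounded operator, with `T₀` as in `plusCLM`. -/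
noncomputable def extensionCLM (T₀ : H →L[ℂ] H) (C : Param V z) : H →L[ℂ] H :=
  diskMobius (-z) (plusCLM T₀ C)

/-- The parameter `C` at `z` of a contractive extension `T = V_{C;z}` of `V`. -/
noncomputable def paramOf (V : H →ₗ.[ℂ] H) (z : ℂ) (T : H →L[ℂ] H) : Param V z :=
  compression (defectSpace V z) (defectSpace V (1 / conj z)) (diskMobius z T)

/-- The parameter at `z₁` of the orthogonal extension whose parameter at `z` is `C`. -/
noncomputable def changeParam (T₀ : H →L[ℂ] H) (z₁ : ℂ) (C : Param V z) : Param V z₁ :=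
  paramOf V z₁ (extensionCLM T₀ C)

theorem norm_paramOf_le (hz : ‖z‖ < 1) (hT : ‖T‖ ≤ 1) : ‖paramOf V z T‖ ≤ 1 :=
  (norm_compression_le _).trans (norm_diskMobius_le hz hT)

theorem analyticAt_paramOf (hz : ‖z‖ < 1) (hT : ‖T‖ ≤ 1) : AnalyticAt ℂ (paramOf V z) T :=
  (analyticAt_compression _).fun_comp (analyticAt_diskMobius (isUnit_one_sub_smul hz hT))

namespace IsContractiveExtension

variable (hT₀ : IsContractiveExtension V T₀) (hV : IsIsometric V) (hVc : V.IsClosed)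
  (hz : ‖z‖ < 1) (hz₀ : z ≠ 0)
include hT₀ hz

theorem plusCLM_apply_sub (C : Param V z) (x : V.domain) :
    plusCLM T₀ C (x - z • V x) = V x - conj z • (x : H) := by
  have hx : (x : H) - z • V x ∈ (defectSpace V z)ᗮ :=
    Submodule.le_orthogonal_orthogonal _ (mem_rangeSpace.2 ⟨x, rfl⟩)
  rw [plusCLM, glue_apply_of_mem_orthogonal _ _ hx, hT₀.diskMobius_apply_sub hz]

include hV hVc

theorem plusOp_eq (C : Param V z) : plusOp C = (plusCLM T₀ C : H →ₗ[ℂ] H).toPMap ⊤ := by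
  suffices h : (mobius V z).graph ⊔ (paramOp C).graph =
      ((plusCLM T₀ C : H →ₗ[ℂ] H).toPMap ⊤).graph by
    refine LinearPMap.eq_of_eq_graph ?_
    rw [plusOp, h, Submodule.toLinearPMap_graph_eq]
    exact fun p hp hp₀ => LinearPMap.graph_fst_eq_zero_snd _ hp hp₀
  refine le_antisymm (sup_le ?_ ?_) ?_
  · rintro ⟨a, b⟩ hab
    obtain ⟨x, rfl, rfl⟩ := (mem_graph_mobius hV hz).1 hab
    exact mem_graph_toPMap_top.2 (hT₀.plusCLM_apply_sub hz C x)
  · rintro ⟨a, b⟩ hab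
    obtain ⟨y, rfl, rfl⟩ := (LinearPMap.mem_graph_iff _).1 hab
    exact mem_graph_toPMap_top.2 (glue_apply_coe _ C y)
  · rintro ⟨a, b⟩ hab
    obtain rfl := mem_graph_toPMap_top.1 hab
    obtain ⟨y, hy, m, hm, rfl⟩ := (defectSpace V z).exists_add_mem_mem_orthogonal a
    rw [hT₀.orthogonal_defectSpace (isClosed_domain hV hVc) hz] at hm
    obtain ⟨x, rfl⟩ := mem_rangeSpace.1 hm
    rw [add_comm, map_add, hT₀.plusCLM_apply_sub hz, plusCLM, glue_apply_coe _ C ⟨y, hy⟩]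
    exact Submodule.add_mem_sup ((mem_graph_mobius hV hz).2 ⟨x, rfl, rfl⟩)
      ((paramOp C).mem_graph ⟨y, hy⟩)

include hz₀

theorem norm_plusCLM_le (hC : ‖C‖ ≤ 1) : ‖plusCLM T₀ C‖ ≤ 1 :=
  norm_glue_le (fun x _ => by
      simpa only [one_mul] using
        (diskMobius z T₀).le_of_opNorm_le (norm_diskMobius_le hz hT₀.norm_le) x)
    (fun x hx => hT₀.diskMobius_mem_orthogonal_defectSpace hz hz₀
      (hT₀.orthogonal_defectSpace (isClosed_domain hV hVc) hz ▸ hx)) hC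

theorem orthogonalExtension_eq (hC : ‖C‖ ≤ 1) :
    orthogonalExtension C = (extensionCLM T₀ C : H →ₗ[ℂ] H).toPMap ⊤ := by
  have h_unit := isUnit_one_sub_smul (z := -z) (by rwa [norm_neg])
    (hT₀.norm_plusCLM_le hV hVc hz hz₀ hC)
  rw [neg_smul, sub_neg_eq_add] at h_unit
  rw [orthogonalExtension, hT₀.plusOp_eq hV hVc hz, toPMap_top_add_smul_idOp,
    idOp_add_smul_toPMap_top, inverse_toPMap_top h_unit, mulOp_toPMap_top, extensionCLM, diskMobius,
    map_neg, neg_smul, neg_smul, sub_neg_eq_add, sub_neg_eq_add]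

protected theorem extensionCLM (hC : ‖C‖ ≤ 1) : IsContractiveExtension V (extensionCLM T₀ C) := by
  have h_norm := hT₀.norm_plusCLM_le hV hVc hz hz₀ hC
  have hz' : ‖-z‖ < 1 := by rwa [norm_neg]
  refine ⟨norm_diskMobius_le hz' h_norm, fun x => ?_⟩
  have h := diskMobius_apply_sub hz' h_norm ((x : H) - z • V x)
  rw [hT₀.plusCLM_apply_sub hz] at h
  have h_arg : x - z • V x - -z • (V x - conj z • (x : H)) = (1 - z * conj z) • (x : H) := by
    module
  have h_value : V x - conj z • (x : H) - conj (-z) • (x - z • V x) = (1 - z * conj z) • V x := by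
    rw [map_neg]
    module
  rw [h_arg, h_value, map_smul] at h
  exact smul_right_injective H (one_sub_mul_conj_ne_zero hz) h

theorem analyticAt_extensionCLM (hC : ‖C‖ ≤ 1) :
    AnalyticAt ℂ (extensionCLM T₀ : Param V z → H →L[ℂ] H) C :=
  (analyticAt_diskMobius (isUnit_one_sub_smul (by rwa [norm_neg])
    (hT₀.norm_plusCLM_le hV hVc hz hz₀ hC))).fun_comp (analyticAt_glue _ C)

theorem extensionCLM_paramOf (hT : IsContractiveExtension V T) :
    extensionCLM T₀ (paramOf V z T) = T := by
  have h_plus : plusCLM T₀ (paramOf V z T) = diskMobius z T := by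
    refine glue_compression (fun y hy => hT.diskMobius_mem_defectSpace hV hz hz₀ hy) fun m hm => ?_
    rw [hT₀.orthogonal_defectSpace (isClosed_domain hV hVc) hz] at hm
    obtain ⟨x, rfl⟩ := mem_rangeSpace.1 hm
    rw [hT₀.diskMobius_apply_sub hz, hT.diskMobius_apply_sub hz]
  rw [extensionCLM, h_plus,
    diskMobius_neg_diskMobius hz (isUnit_one_sub_smul hz hT.norm_le)]

theorem paramOf_extensionCLM (hC : ‖C‖ ≤ 1) : paramOf V z (extensionCLM T₀ C) = C := by
  rw [paramOf, extensionCLM,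
    diskMobius_diskMobius_neg hz (hT₀.norm_plusCLM_le hV hVc hz hz₀ hC), plusCLM, compression_glue]

end IsContractiveExtension

end Parameter

section ChangeOfParameter

variable {H : Type*} [NormedAddCommGroup H] [InnerProductSpace ℂ H] [CompleteSpace H]
  {V : H →ₗ.[ℂ] H} {z : ℂ} {T₀ : H →L[ℂ] H} (hT₀ : IsContractiveExtension V T₀)
  (hV : IsIsometric V) (hVc : V.IsClosed) (hz : ‖z‖ < 1) (hz₀ : z ≠ 0)
include hT₀ hV hVc hz hz₀

namespace IsContractiveExtension

variable {z₁ : ℂ} (hz₁ : ‖z₁‖ < 1) {C : Param V z} (hC : ‖C‖ ≤ 1)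
include hz₁ hC

theorem norm_changeParam_le : ‖changeParam T₀ z₁ C‖ ≤ 1 :=
  norm_paramOf_le hz₁ (hT₀.extensionCLM hV hVc hz hz₀ hC).norm_le

theorem analyticAt_changeParam :
    AnalyticAt ℂ (changeParam T₀ z₁ : Param V z → Param V z₁) C :=
  (analyticAt_paramOf hz₁ (hT₀.extensionCLM hV hVc hz hz₀ hC).norm_le).fun_comp
    (hT₀.analyticAt_extensionCLM hV hVc hz hz₀ hC)

theorem orthogonalExtension_changeParam (hz₁₀ : z₁ ≠ 0) :
    orthogonalExtension (changeParam T₀ z₁ C) = orthogonalExtension C := by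
  rw [hT₀.orthogonalExtension_eq hV hVc hz₁ hz₁₀
      (hT₀.norm_changeParam_le hV hVc hz hz₀ hz₁ hC), changeParam,
    hT₀.extensionCLM_paramOf hV hVc hz₁ hz₁₀ (hT₀.extensionCLM hV hVc hz hz₀ hC),
    hT₀.orthogonalExtension_eq hV hVc hz hz₀ hC]

end IsContractiveExtension

namespace IsIninParameter

variable {R : ℂ → H →L[ℂ] H} {C C' : ℂ → Param V z}

theorem eq_inverse (hC : IsIninParameter V R z C) {ζ : ℂ} (hζ : ζ ∈ Metric.ball (0 : ℂ) 1) :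
    R ζ = Ring.inverse (1 - ζ • extensionCLM T₀ (C ζ)) := by
  have hCζ := hC.1.2 ζ hζ
  have h_unit := isUnit_one_sub_smul (mem_ball_zero_iff.1 hζ)
    (hT₀.extensionCLM hV hVc hz hz₀ hCζ).norm_le
  apply toPMap_top_injective
  beta_reduce
  rw [hC.2 ζ hζ, hT₀.orthogonalExtension_eq hV hVc hz hz₀ hCζ, idOp_sub_smul_toPMap_top,
    inverse_toPMap_top h_unit]

theorem eq_of_ne_zero (hC : IsIninParameter V R z C) (hC' : IsIninParameter V R z C') {ζ : ℂ}
    (hζ : ζ ∈ Metric.ball (0 : ℂ) 1) (hζ₀ : ζ ≠ 0) : C ζ = C' ζ := by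
  have hCζ := hC.1.2 ζ hζ
  have hCζ' := hC'.1.2 ζ hζ
  have h_unit {D : Param V z} (hD : ‖D‖ ≤ 1) : IsUnit (1 - ζ • extensionCLM T₀ D) :=
    isUnit_one_sub_smul (mem_ball_zero_iff.1 hζ) (hT₀.extensionCLM hV hVc hz hz₀ hD).norm_le
  have h_inverse := (hC.eq_inverse hT₀ hV hVc hz hz₀ hζ).symm.trans
    (hC'.eq_inverse hT₀ hV hVc hz hz₀ hζ)
  have h_one_sub : 1 - ζ • extensionCLM T₀ (C ζ) = 1 - ζ • extensionCLM T₀ (C' ζ) := by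
    rw [← Ring.inverse_inverse (h_unit hCζ), h_inverse, Ring.inverse_inverse (h_unit hCζ')]
  have h_extension : extensionCLM T₀ (C ζ) = extensionCLM T₀ (C' ζ) :=
    smul_right_injective _ hζ₀ (sub_right_injective h_one_sub)
  rw [← hT₀.paramOf_extensionCLM hV hVc hz hz₀ hCζ, h_extension,
    hT₀.paramOf_extensionCLM hV hVc hz hz₀ hCζ']

theorem eqOn (hC : IsIninParameter V R z C) (hC' : IsIninParameter V R z C') :
    Set.EqOn C C' (Metric.ball 0 1) := by
  intro ζ hζ
  rcases eq_or_ne ζ 0 with rfl | hζ₀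
  · -- `R 0 = 1` carries no information on the value at `0`, which is recovered by continuity.
    have h_near : C =ᶠ[𝓝[≠] 0] C' := by
      filter_upwards [self_mem_nhdsWithin,
        mem_nhdsWithin_of_mem_nhds (Metric.ball_mem_nhds (0 : ℂ) one_pos)] with ζ hζ₀ hζ
      exact hC.eq_of_ne_zero hT₀ hV hVc hz hz₀ hC' hζ hζ₀
    exact (((hC.1.1 0 hζ).continuousAt.eventuallyEq_nhds_iff_eventuallyEq_nhdsNE
      (hC'.1.1 0 hζ).continuousAt).1 h_near).eq_of_nhds
  · exact hC.eq_of_ne_zero hT₀ hV hVc hz hz₀ hC' hζ hζ₀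

theorem changeParam {z₁ : ℂ} (hz₁ : ‖z₁‖ < 1) (hz₁₀ : z₁ ≠ 0) (hC : IsIninParameter V R z C) :
    IsIninParameter V R z₁ fun ζ => changeParam T₀ z₁ (C ζ) := by
  refine ⟨⟨fun ζ hζ => ?_, fun ζ hζ => ?_⟩, fun ζ hζ => ?_⟩
  · exact (hT₀.analyticAt_changeParam hV hVc hz hz₀ hz₁ (hC.1.2 ζ hζ)).fun_comp (hC.1.1 ζ hζ)
  · exact hT₀.norm_changeParam_le hV hVc hz hz₀ hz₁ (hC.1.2 ζ hζ)
  · rw [hC.2 ζ hζ, hT₀.orthogonalExtension_changeParam hV hVc hz hz₀ hz₁ (hC.1.2 ζ hζ) hz₁₀]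

end IsIninParameter

end ChangeOfParameter

end IsometricOp

open IsometricOp in
theorem theorem3p1_general {H : Type*} [NormedAddCommGroup H] [InnerProductSpace ℂ H]
    [CompleteSpace H] (V : H →ₗ.[ℂ] H) (hV : IsIsometric V) (hVc : V.IsClosed)
    (R : ℂ → H →L[ℂ] H) {ι : Type*} {l : Filter ι} [l.NeBot] (lam : ι → ℂ)
    (hlam : ∀ᶠ k in l, ‖lam k‖ < 1) (z₀ : ℂ) (hz₀ : ‖z₀‖ < 1) (hz₀' : z₀ ≠ 0)
    (C : ℂ → Param V z₀) (hC : IsIninParameter V R z₀ C) (CHat : Param V z₀)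
    (hCHat : Tendsto (fun k => C (lam k)) l (𝓝 CHat)) :
    ∀ z₁ : ℂ, ‖z₁‖ < 1 → z₁ ≠ 0 →
      (∃ C₁ : ℂ → Param V z₁, IsIninParameter V R z₁ C₁) ∧
      ∀ C₁ : ℂ → Param V z₁, IsIninParameter V R z₁ C₁ →
        ∃ C₁Hat : Param V z₁, Tendsto (fun k => C₁ (lam k)) l (𝓝 C₁Hat) ∧ ‖C₁Hat‖ ≤ 1 ∧
          orthogonalExtension C₁Hat = orthogonalExtension CHat := by
  intro z₁ hz₁ hz₁'
  obtain ⟨T₀, hT₀⟩ := exists_isContractiveExtension hV hVc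
  have hCHat_norm : ‖CHat‖ ≤ 1 := le_of_tendsto ((continuous_norm.tendsto CHat).comp hCHat)
    (hlam.mono fun k hk => hC.1.2 _ (mem_ball_zero_iff.2 hk))
  have h_change := hC.changeParam hT₀ hV hVc hz₀ hz₀' hz₁ hz₁'
  refine ⟨⟨_, h_change⟩, fun C₁ hC₁ => ⟨changeParam T₀ z₁ CHat, ?_,
    hT₀.norm_changeParam_le hV hVc hz₀ hz₀' hz₁ hCHat_norm,
    hT₀.orthogonalExtension_changeParam hV hVc hz₀ hz₀' hz₁ hCHat_norm hz₁'⟩⟩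
  have h_tendsto : Tendsto (fun k => changeParam T₀ z₁ (C (lam k))) l
      (𝓝 (changeParam T₀ z₁ CHat)) :=
    (hT₀.analyticAt_changeParam hV hVc hz₀ hz₀' hz₁ hCHat_norm).continuousAt.tendsto.comp hCHat
  refine h_tendsto.congr' (hlam.mono fun k hk => ?_)
  exact h_change.eqOn hT₀ hV hVc hz₁ hz₁' hC₁ (mem_ball_zero_iff.2 hk)

theorem theorem3p1
    {H K : Type*}
    [NormedAddCommGroup H] [InnerProductSpace ℂ H] [CompleteSpace H]
    [NormedAddCommGroup K] [InnerProductSpace ℂ K] [CompleteSpace K]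
    (V : H →ₗ.[ℂ] H) (hV : IsometricOp.IsIsometric V) (hVc : V.IsClosed)
    (J : H →ₗᵢ[ℂ] K) (U : K ≃ₗᵢ[ℂ] K) (hU : ∀ x : V.domain, U (J x) = J (V x))
    (lam : ℕ → ℂ) (hlam : ∀ k, ‖lam k‖ < 1)
    (lamHat : ℂ) (hlamHat : ‖lamHat‖ = 1) (hlim : Tendsto lam atTop (𝓝 lamHat))
    (z₀ : ℂ) (hz₀ : ‖z₀‖ < 1) (hz₀' : z₀ ≠ 0)
    (C : ℂ → IsometricOp.Param V z₀)
    (hC : IsometricOp.IsIninParameter V (IsometricOp.generalizedResolvent J U) z₀ C)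
    (CHat : IsometricOp.Param V z₀)
    (hCHat : Tendsto (fun k => C (lam k)) atTop (𝓝 CHat)) :
    ∀ z₁ : ℂ, ‖z₁‖ < 1 → z₁ ≠ 0 →
      (∃ C₁ : ℂ → IsometricOp.Param V z₁,
        IsometricOp.IsIninParameter V (IsometricOp.generalizedResolvent J U) z₁ C₁) ∧
      ∀ C₁ : ℂ → IsometricOp.Param V z₁,
        IsometricOp.IsIninParameter V (IsometricOp.generalizedResolvent J U) z₁ C₁ →
        ∃ C₁Hat : IsometricOp.Param V z₁,
          Tendsto (fun k => C₁ (lam k)) atTop (𝓝 C₁Hat) ∧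
          ‖C₁Hat‖ ≤ 1 ∧
          IsometricOp.orthogonalExtension C₁Hat = IsometricOp.orthogonalExtension CHat :=
  theorem3p1_general V hV hVc _ lam (.of_forall hlam) z₀ hz₀ hz₀' C hC CHat hCHat
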